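/- Let $\mathbb F=\mathbb Z/2\mathbb Z$ and let $q>p\ge 3$ be coprime integers. Let $T_{p,-q}$ be the Legendrian representative of the $(p,-q)$-torus knot given by the following simple front diagram (all right cusps have the same abscissa). - At the left edge there are $p$ left cusps, numbered $1,\dots,p$ from top to bottom. For all $1\le i<j\le p$ the lower strand at cusp $i$ and the upper strand at cusp $j$ cross once, in a crossing called $x_{i,j}$; after these crossings the $p$ upper strands lie above the $p$ lower strands, both in the order of the cusps. - In the gap between the upper and the lower strands there are then $q-p$ further left cusps, one below the other. - The $2q$ strands end at $q$ right cusps $z_1,\dots,z_q$, numbered from top to bottom. To the right of the inner left cusps, the lower strand at $z_i$ and the upper strand at $z_j$ cross once, in a crossing called $y_{i,j}$, for all $1\le i<j\le\min(q,i+p-1)$, and there are no other crossings. Let $Ch(T_{p,-q})$ be the Chekanov–Eliashberg algebra over $\mathbb F$ of this front: the free unital associative $\mathbb F$-algebra on the crossings and the right cusps. Its differential $\partial$ is $\mathbb F$-linear with $\partial(vw)=(\partial v)w+v(\partial w)$. For a generator $v$, $\partial v$ is the sum of the words of all admissible embedded disks with initial vertex $v$, plus $1$ if $v$ is a right cusp.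 Such a disk lies between an upper and a lower path, both graphs over the horizontal axis, which run along the front from a common left cusp to $v$ and do not meet in between; it fills the left quadrant at $v$; and both paths are smooth except for convex corners at crossings, where the disk fills exactly the bottom quadrant (corner of the upper path) or exactly the top quadrant (corner of the lower path). Its word is the product of its corners other than $v$, read counterclockwise along the boundary starting from $v$. The characteristic algebra $\mathcal C(T_{p,-q})$ is the quotient of $Ch(T_{p,-q})$ by the two-sided ideal generated by $\mathrm{Im}\,\partial$. Let $a,b\in\mathrm{Mat}_2(\mathbb F)$ with $a^2=b^2=0$ and $ab+ba=1$ (for instance $a=\begin{pmatrix}0&1\\0&0\end{pmatrix}$, $b=\begin{pmatrix}0&0\\1&0\end{pmatrix}$), and let $f:Ch(T_{p,-q})\to\mathrm{Mat}_2(\mathbb F)$ be the homomorphism of unital $\mathbb F$-algebras with $$x_{i,i+1}\mapsto a\ (1\le i\le p-1),\quad y_{j,j+p-1}\mapsto a\ (1\le j\le q-p+1),\quad x_{1,p}\mapsto b,\quad y_{j,j+1}\mapsto b\ (1\le j\le q-1),$$ and with all other generators sent to $0$. **Proposition.** $f(\partial v)=0$ for all $v\in Ch(T_{p,-q})$. Hence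 there is a unique homomorphism of unital $\mathbb F$-algebras $\varphi:\mathcal C(T_{p,-q})\to\mathrm{Mat}_2(\mathbb F)$ whose composition with the quotient map $Ch(T_{p,-q})\to\mathcal C(T_{p,-q})$ is $f$. -/

import Mathlib

/-- The events met when a front diagram is swept from left to right.  The strands over a generic
abscissa are numbered `0, 1, 2, …` from top to bottom.  `leftCusp k` creates two new strands, in
positions `k` and `k + 1` (the strands that were in positions `≥ k` are pushed down by two);
`crossing k n` is a crossing, labelled `n`, of the strands in positions `k` and `k + 1`. -/
inductive FrontEvent (ι : Type) where
  | leftCusp (k : ℕ)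
  | crossing (k : ℕ) (name : ι)

namespace FrontEvent

variable {ι : Type}

/-- `Drawable m es`: the events `es` can be drawn one after the other, starting from `m` strands. -/
def Drawable : ℕ → List (FrontEvent ι) → Prop
  | _, [] => True
  | m, leftCusp k :: es => k ≤ m ∧ Drawable (m + 2) es
  | m, crossing k _ :: es => k + 1 < m ∧ Drawable m es

/-- The number of left cusps in a list of events. -/
def cusps : List (FrontEvent ι) → ℕ
  | [] => 0
  | leftCusp _ :: es => cusps es + 1
  | crossing _ _ :: es => cusps es

/-- The position, just after the event, of the strand which is in position `m` just before it. -/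
def follow : FrontEvent ι → ℕ → ℕ
  | leftCusp k, m => if k ≤ m then m + 2 else m
  | crossing k _, m => if m = k then k + 1 else if m = k + 1 then k else m

theorem follow_le (e : FrontEvent ι) (m : ℕ) : e.follow m ≤ m + 2 := by
  cases e <;> simp only [follow] <;> split_ifs <;> omega

theorem cusps_append (es fs : List (FrontEvent ι)) : cusps (es ++ fs) = cusps es + cusps fs := by
  induction es with
  | nil => simp [cusps]
  | cons e es ih => cases e <;> simp [cusps, ih]; omega

theorem drawable_append (m : ℕ) (es fs : List (FrontEvent ι)) :
    Drawable m (es ++ fs) ↔ Drawable m es ∧ Drawable (m + 2 * cusps es) fs := by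
  induction es generalizing m with
  | nil => simp [Drawable, cusps]
  | cons e es ih =>
    cases e with
    | leftCusp k =>
      have h : m + 2 + 2 * cusps es = m + 2 * (cusps es + 1) := by ring
      simp [Drawable, cusps, ih, and_assoc, h]
    | crossing k n => simp [Drawable, cusps, ih, and_assoc]

end FrontEvent

/-- A simple front (all right cusps have the same abscissa, to the right of every other singular
point), up to planar isotopy: a drawable list of left cusps and crossings.  If there are `n` left
cusps, the `2 * n` strands at the right end are closed up by `n` right cusps, the `i`-th of which
(`i = 0, …, n - 1` from top to bottom) joins the strands in positions `2 * i` and `2 * i + 1`. -/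
structure SimpleFront (ι : Type) where
  events : List (FrontEvent ι)
  drawable : FrontEvent.Drawable 0 events

namespace SimpleFront

variable {ι : Type} (F : SimpleFront ι)

/-- The crossings of a front. -/
@[ext] structure Crossing where
  index : ℕ
  pos : ℕ
  name : ι
  isCrossing : F.events[index]? = some (.crossing pos name)

/-- The generators: the crossings and the right cusps (numbered from `0`, top to bottom). -/
abbrev Generator := F.Crossing ⊕ Fin (FrontEvent.cusps F.events)

/-- The underlying algebra of the Chekanov–Eliashberg algebra over the field with two elements. -/
abbrev Ch := FreeAlgebra (ZMod 2) F.Generator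

/-- The crossing which is the event number `t`, if that event is a crossing. -/
def crossingAt (t : ℕ) : Option F.Crossing :=
  match h : F.events[t]? with
  | some (.crossing k n) => some ⟨t, k, n, h⟩
  | _ => none

/-- The upper boundary of a disk passes from position `m` before the event `t` to position `m'`
after it with a convex corner: the event is a crossing, the boundary comes from the lower left and
leaves to the lower right, so that near the crossing the disk fills exactly the bottom quadrant. -/
def TopCorner (t m m' : ℕ) : Prop :=
  ∃ k n, F.events[t]? = some (.crossing k n) ∧ m = k + 1 ∧ m' = k + 1

/-- The same for the lower boundary of a disk: it comes from the upper left and leaves to the upper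
right, so that near the crossing the disk fills exactly the top quadrant. -/
def BotCorner (t m m' : ℕ) : Prop :=
  ∃ k n, F.events[t]? = some (.crossing k n) ∧ m = k ∧ m' = k

/-- The boundary follows a strand of the front through the event `t`. -/
def Smooth (t m m' : ℕ) : Prop :=
  ∃ e, F.events[t]? = some e ∧ m' = e.follow m

/-- `F.IsStrip t γ`: `γ` is the part to the left of the abscissa just before event `t` of an
admissible embedded disk whose initial vertex is further to the right.  The boundary of such a disk
consists of an upper and a lower path from one left cusp to the initial vertex; `γ` lists the
positions `(upper, lower)` of the two paths before event `t`, before event `t - 1`, …, down to the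
left cusp where they start.  Both paths follow the front except at convex corners, and the upper one
stays strictly above the lower one. -/
inductive IsStrip : ℕ → List (ℕ × ℕ) → Prop
  | start (t k : ℕ) (h : F.events[t]? = some (.leftCusp k)) : IsStrip (t + 1) [(k, k + 1)]
  | step (t i j i' j' : ℕ) (γ : List (ℕ × ℕ)) (h : IsStrip t ((i, j) :: γ))
      (htop : F.Smooth t i i' ∨ F.TopCorner t i i')
      (hbot : F.Smooth t j j' ∨ F.BotCorner t j j')
      (hlt : i' < j') : IsStrip (t + 1) ((i', j') :: (i, j) :: γ)

/-- The number of events to the left of a generator. -/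
def slice : F.Generator → ℕ
  | .inl c => c.index
  | .inr _ => F.events.length

/-- The position, just to the left of a generator, of the upper of the two strands meeting there. -/
def height : F.Generator → ℕ
  | .inl c => c.pos
  | .inr i => 2 * i

/-- The admissible embedded disks with initial vertex `v`: the upper and the lower path meet at `v`,
and the disk fills the left quadrant at `v`. -/
def disks (v : F.Generator) : Set (List (ℕ × ℕ)) :=
  {γ | F.IsStrip (F.slice v) γ ∧ γ.head? = some (F.height v, F.height v + 1)}

/-- The corner of the upper path at event `t`, as a list of length at most one. -/
def topCornerAt (t i i' : ℕ) : List F.Crossing :=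
  ((F.crossingAt t).filter fun c => i = c.pos + 1 ∧ i' = c.pos + 1).toList

/-- The corner of the lower path at event `t`, as a list of length at most one. -/
def botCornerAt (t j j' : ℕ) : List F.Crossing :=
  ((F.crossingAt t).filter fun c => j = c.pos ∧ j' = c.pos).toList

/-- The corners of the upper path, listed from right to left. -/
def topCorners : ℕ → List (ℕ × ℕ) → List F.Crossing
  | t + 1, p' :: p :: γ => F.topCornerAt t p.1 p'.1 ++ topCorners t (p :: γ)
  | _, _ => []

/-- The corners of the lower path, listed from left to right. -/
def botCorners : ℕ → List (ℕ × ℕ) → List F.Crossing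
  | t + 1, p' :: p :: γ => botCorners t (p :: γ) ++ F.botCornerAt t p.2 p'.2
  | _, _ => []

/-- The product of the corners of a disk with initial vertex `v`, read counterclockwise along its
boundary starting from `v`. -/
def word (v : F.Generator) (γ : List (ℕ × ℕ)) : F.Ch :=
  ((F.topCorners (F.slice v) γ ++ F.botCorners (F.slice v) γ).map
    fun c => FreeAlgebra.ι (ZMod 2) (Sum.inl c : F.Generator)).prod

theorem finite_isStrip (t : ℕ) : {γ | F.IsStrip t γ}.Finite := by
  induction t with
  | zero =>
    refine Set.Finite.subset Set.finite_empty ?_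
    rintro γ h
    cases h
  | succ t ih =>
    have hstart : {γ | ∃ k, F.events[t]? = some (.leftCusp k) ∧ γ = [(k, k + 1)]}.Finite := by
      refine Set.Subsingleton.finite ?_
      rintro _ ⟨k, hk, rfl⟩ _ ⟨l, hl, rfl⟩
      rw [hk] at hl
      simp only [Option.some.injEq, FrontEvent.leftCusp.injEq] at hl
      rw [hl]
    have hstep : (⋃ δ ∈ {γ | F.IsStrip t γ},
        (fun p : ℕ × ℕ => p :: δ) ''
          (Set.Iic ((δ.headD (0, 0)).1 + 2) ×ˢ Set.Iic ((δ.headD (0, 0)).2 + 2))).Finite :=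
      ih.biUnion fun δ _ => ((Set.finite_Iic _).prod (Set.finite_Iic _)).image _
    refine (hstart.union hstep).subset ?_
    rintro γ h
    cases h with
    | start _ k h => exact Or.inl ⟨k, h, rfl⟩
    | step _ i j i' j' γ h htop hbot hlt =>
      refine Or.inr (Set.mem_biUnion (x := (i, j) :: γ) h ⟨(i', j'), ⟨?_, ?_⟩, rfl⟩)
      · rcases htop with ⟨e, -, rfl⟩ | ⟨k, n, -, rfl, rfl⟩
        · exact e.follow_le i
        · simp
      · rcases hbot with ⟨e, -, rfl⟩ | ⟨k, n, -, rfl, rfl⟩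
        · exact e.follow_le j
        · simp

theorem finite_disks (v : F.Generator) : (F.disks v).Finite :=
  (F.finite_isStrip (F.slice v)).subset fun _ h => h.1

/-- The differential of a generator: the sum of the words of the admissible disks with initial
vertex at that generator, plus `1` if the generator is a right cusp. -/
noncomputable def dGen (v : F.Generator) : F.Ch :=
  (match v with
    | .inl _ => 0
    | .inr _ => 1) + ∑ γ ∈ (F.finite_disks v).toFinset, F.word v γ

/-- The algebra map `x ↦ x + ε ∂x` into the dual numbers which encodes the Leibniz rule. -/
noncomputable def dHom : F.Ch →ₐ[ZMod 2] TrivSqZeroExt F.Ch F.Ch :=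
  FreeAlgebra.lift (ZMod 2) fun v =>
    TrivSqZeroExt.inl (FreeAlgebra.ι (ZMod 2) v) + TrivSqZeroExt.inr (F.dGen v)

/-- The differential `∂` of the Chekanov–Eliashberg algebra. -/
noncomputable def d (x : F.Ch) : F.Ch := (F.dHom x).snd

theorem d_ι (v : F.Generator) : F.d (FreeAlgebra.ι (ZMod 2) v) = F.dGen v := by
  simp [d, dHom]

theorem d_add (x y : F.Ch) : F.d (x + y) = F.d x + F.d y := by
  simp [d]

theorem d_one : F.d 1 = 0 := by
  simp [d]

theorem fst_dHom (x : F.Ch) : (F.dHom x).fst = x := by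
  have h : (TrivSqZeroExt.fstHom (ZMod 2) F.Ch F.Ch).comp F.dHom = AlgHom.id (ZMod 2) F.Ch := by
    apply FreeAlgebra.hom_ext
    funext v
    simp [dHom]
  exact DFunLike.congr_fun h x

theorem d_mul (x y : F.Ch) : F.d (x * y) = F.d x * y + x * F.d y := by
  simp [d, fst_dHom, add_comm]

/-- The characteristic algebra: the quotient of `F.Ch` by the two-sided ideal generated by the
image of the differential. -/
abbrev CharAlg := (TwoSidedIdeal.span (Set.range F.d)).ringCon.Quotient

/-- The quotient map onto the characteristic algebra. -/
noncomputable def toCharAlg : F.Ch →ₐ[ZMod 2] F.CharAlg :=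
  RingCon.mkₐ (ZMod 2) (TwoSidedIdeal.span (Set.range F.d)).ringCon

end SimpleFront

/-- The names of the crossings of `T_{p,-q}`, with the cusps numbered from `1`, top to bottom:
`x i j` is the crossing of the lower strand at the leftmost left cusp `i` with the upper strand at
the leftmost left cusp `j`; `y i j` is the crossing of the lower strand at the right cusp `i` with
the upper strand at the right cusp `j` (`i < j` in both cases). -/
inductive TorusCrossing where
  | x (i j : ℕ)
  | y (i j : ℕ)

/-- The `p` left cusps at the left edge of the diagram of `T_{p,-q}`, one below the other. -/
def torusOuterCusps (p : ℕ) : List (FrontEvent TorusCrossing) :=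
  (List.range p).map fun k => .leftCusp (2 * k)

/-- The left half: for `j = 2, …, p` the upper strand at cusp `j` goes up and crosses the lower
strands at the cusps `j - 1, …, 1`, in this order.  In the end the `p` upper strands lie above the
`p` lower strands, both in the order of the cusps. -/
def torusLeft (p : ℕ) : List (FrontEvent TorusCrossing) :=
  (List.range' 1 p).flatMap fun j =>
    (List.range' 1 (j - 1)).reverse.map fun i => .crossing (i + j - 2) (.x i j)

/-- The `q - p` left cusps in the innermost region, one below the other, below the `p` upper and
above the `p` lower strands of the left half. -/
def torusInnerCusps (p q : ℕ) : List (FrontEvent TorusCrossing) :=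
  (List.range (q - p)).map fun k => .leftCusp (p + 2 * k)

/-- The right half: write `u_i`, `l_i` for the upper and the lower strand at the right cusp `i`.
Left of this part the strands are, from top to bottom,
`u_1, …, u_p, l_1, u_{p+1}, l_2, u_{p+2}, …, l_{q-p}, u_q, l_{q-p+1}, …, l_q`.
For `i = 1, …, q` the strand `l_i` goes up and crosses `u_j` for
`j = min q (i + p - 1), …, i + 1`, in this order.  In the end the order is `u_1, l_1, …, u_q, l_q`. -/
def torusRight (p q : ℕ) : List (FrontEvent TorusCrossing) :=
  (List.range' 1 q).flatMap fun i =>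
    (List.range' (i + 1) (min q (i + p - 1) - i)).reverse.map fun j =>
      .crossing (i + j - 2) (.y i j)

/-- The events of the front diagram of `T_{p,-q}`. -/
def torusEvents (p q : ℕ) : List (FrontEvent TorusCrossing) :=
  torusOuterCusps p ++ torusLeft p ++ torusInnerCusps p q ++ torusRight p q

theorem cusps_map_leftCusp (l : List ℕ) (g : ℕ → ℕ) :
    FrontEvent.cusps (l.map fun k => (FrontEvent.leftCusp (g k) : FrontEvent TorusCrossing)) =
      l.length := by
  induction l with
  | nil => rfl
  | cons a l ih => simp [FrontEvent.cusps, ih]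

theorem drawable_map_leftCusp (n m c : ℕ) (h : c ≤ m) :
    FrontEvent.Drawable m ((List.range n).map fun k =>
      (FrontEvent.leftCusp (c + 2 * k) : FrontEvent TorusCrossing)) := by
  induction n with
  | zero => trivial
  | succ n ih =>
    rw [List.range_succ, List.map_append, FrontEvent.drawable_append, cusps_map_leftCusp]
    refine ⟨ih, ?_⟩
    simp only [List.map_cons, List.map_nil, FrontEvent.Drawable, List.length_range, and_true]
    omega

theorem crossings_drawable (m : ℕ) (es : List (FrontEvent TorusCrossing))
    (h : ∀ e ∈ es, ∃ k n, e = .crossing k n ∧ k + 1 < m) :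
    FrontEvent.Drawable m es ∧ FrontEvent.cusps es = 0 := by
  induction es with
  | nil => exact ⟨trivial, rfl⟩
  | cons e es ih =>
    obtain ⟨k, n, rfl, hk⟩ := h e (by simp)
    obtain ⟨h1, h2⟩ := ih fun e he => h e (by simp [he])
    exact ⟨⟨hk, h1⟩, h2⟩

theorem torusLeft_drawable (p : ℕ) :
    FrontEvent.Drawable (2 * p) (torusLeft p) ∧ FrontEvent.cusps (torusLeft p) = 0 := by
  apply crossings_drawable
  intro e he
  simp only [torusLeft, List.mem_flatMap, List.mem_map, List.mem_reverse, List.mem_range'_1] at he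
  obtain ⟨j, hj, i, hi, rfl⟩ := he
  exact ⟨_, _, rfl, by omega⟩

theorem torusRight_drawable (p q : ℕ) :
    FrontEvent.Drawable (2 * q) (torusRight p q) ∧ FrontEvent.cusps (torusRight p q) = 0 := by
  apply crossings_drawable
  intro e he
  simp only [torusRight, List.mem_flatMap, List.mem_map, List.mem_reverse,
    List.mem_range'_1] at he
  obtain ⟨i, hi, j, hj, rfl⟩ := he
  exact ⟨_, _, rfl, by omega⟩

theorem drawable_mono {m m' : ℕ} (h : m ≤ m') (es : List (FrontEvent TorusCrossing))
    (hes : FrontEvent.Drawable m es) : FrontEvent.Drawable m' es := by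
  induction es generalizing m m' with
  | nil => trivial
  | cons e es ih =>
    cases e with
    | leftCusp k => exact ⟨hes.1.trans h, ih (by omega) hes.2⟩
    | crossing k n => exact ⟨hes.1.trans_le h, ih h hes.2⟩

theorem torusEvents_drawable (p q : ℕ) : FrontEvent.Drawable 0 (torusEvents p q) := by
  have h1 : FrontEvent.cusps (torusOuterCusps p) = p := by
    simpa [torusOuterCusps] using cusps_map_leftCusp (List.range p) (fun k => 2 * k)
  have h2 : FrontEvent.cusps (torusInnerCusps p q) = q - p := by
    simpa [torusInnerCusps] using cusps_map_leftCusp (List.range (q - p)) (fun k => p + 2 * k)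
  simp only [torusEvents, FrontEvent.drawable_append, FrontEvent.cusps_append, h1, h2,
    (torusLeft_drawable p).2, zero_add, add_zero]
  refine ⟨⟨⟨?_, (torusLeft_drawable p).1⟩, ?_⟩, ?_⟩
  · simpa [torusOuterCusps] using drawable_map_leftCusp p 0 0 le_rfl
  · exact drawable_map_leftCusp (q - p) (2 * p) p (by omega)
  · exact drawable_mono (by omega) _ (torusRight_drawable p q).1

/-- The diagram of `T_{p,-q}` has `q` left cusps in total, hence `q` right cusps. -/
theorem cusps_torusEvents {p q : ℕ} (h : p ≤ q) : FrontEvent.cusps (torusEvents p q) = q := by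
  have h1 : FrontEvent.cusps (torusOuterCusps p) = p := by
    simpa [torusOuterCusps] using cusps_map_leftCusp (List.range p) (fun k => 2 * k)
  have h2 : FrontEvent.cusps (torusInnerCusps p q) = q - p := by
    simpa [torusInnerCusps] using cusps_map_leftCusp (List.range (q - p)) (fun k => p + 2 * k)
  simp only [torusEvents, FrontEvent.cusps_append, h1, h2, (torusLeft_drawable p).2,
    (torusRight_drawable p q).2]
  omega

/-- The front diagram of the Legendrian `(p, -q)`-torus knot `T_{p,-q}` (for `q > p`): `p` left
cusps at the left edge, `q - p` left cusps in the innermost region, and `q` right cusps. -/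
def torusFront (p q : ℕ) : SimpleFront TorusCrossing where
  events := torusEvents p q
  drawable := torusEvents_drawable p q

/-- The values of the map `f` on the generators of `Ch(T_{p,-q})`: `x_{i,i+1}` and `y_{j,j+p-1}` go
to `a`, `x_{1,p}` and `y_{j,j+1}` go to `b`, and all other generators go to `0`. -/
def torusRepGen {M : Type} [Zero M] (p q : ℕ) (a b : M) : (torusFront p q).Generator → M
  | .inl c =>
    match c.name with
    | .x i j => if j = i + 1 then a else if i = 1 ∧ j = p then b else 0
    | .y i j => if j + 1 = i + p then a else if j = i + 1 then b else 0
  | .inr _ => 0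

/-- The standard choice of `a` and `b`. -/
theorem standard_pair :
    (!![0, 1; 0, 0] : Matrix (Fin 2) (Fin 2) (ZMod 2)) ^ 2 = 0 ∧
      (!![0, 0; 1, 0] : Matrix (Fin 2) (Fin 2) (ZMod 2)) ^ 2 = 0 ∧
      (!![0, 1; 0, 0] * !![0, 0; 1, 0] + !![0, 0; 1, 0] * !![0, 1; 0, 0] :
        Matrix (Fin 2) (Fin 2) (ZMod 2)) = 1 := by
  decide

/-- The algebra homomorphism `f : Ch(T_{p,-q}) → Mat₂(𝔽₂)`. -/
noncomputable def torusRep (p q : ℕ) (a b : Matrix (Fin 2) (Fin 2) (ZMod 2)) :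
    (torusFront p q).Ch →ₐ[ZMod 2] Matrix (Fin 2) (Fin 2) (ZMod 2) :=
  FreeAlgebra.lift (ZMod 2) (torusRepGen p q a b)

/-!
The differential is computed by sweeping the front from left to right.  Fix values of the crossings
in a semiring `M` and let `W i j` be the sum, over all strips (left parts of disks) whose upper and lower
path end in positions `i` and `j`, of the products of the values of their corners.  Each event of the
front transforms `W` by an explicit rule (`SimpleFront.stripSum_eq_transferList`).  The image of the
differential of a crossing in positions `k`, `k + 1` is the entry `W k (k + 1)` just before it, and
that of a right cusp is `1 + W (2 * i) (2 * i + 1)` at the right end.  So it suffices that the former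
entries are `0` and the latter are `1` (`SimpleFront.map_dGen_eq_zero`).

If `W` is read as a matrix `V` indexed by strands instead of positions, a crossing of `s` (coming
from above) with `t` (coming from below) and value `c` replaces `V` by
`(1 + c E_{s,t}) V (1 + c E_{s,t})` (`Describes.crossing`).  For the torus front this gives closed
formulas.  In the left half the differential of `x i j` is `∑ k, x i k * x k j`, and all of these
products vanish because `a * a = 0` and `p ≥ 3`.  In the right half the entry of `V` for the upper
strand `m` and the lower strand `n` is, for `n ≤ m`, a sum of products `x * y` and `y * y` of two
values.  For `n < m` all of these products vanish, which takes care of the crossings `y n m`.  For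
`n = m` exactly one product `a * b` and exactly one product `b * a` survive
(`IsRightMatrix`, `IsRightMatrix.crossing`), so that the entry at each right cusp is
`a * b + b * a = 1`.
-/

/-! ### Transfer of weighted disk counts through an event -/

namespace FrontEvent

variable {ι : Type} {M : Type} [Semiring M]

/-- The effect of an event on the weighted counts `W i j` of the strips whose upper and lower path
are in positions `i` and `j`.  The weight `val n` is that of a corner at a crossing labelled `n`.
Only the entries with `i < j` are meaningful; at a crossing the others are set to `0`. -/
noncomputable def transfer (val : ι → M) : FrontEvent ι → (ℕ → ℕ → M) → ℕ → ℕ → M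
  | leftCusp k, W, i, j =>
    if i = k ∧ j = k + 1 then 1
    else if i = k ∨ i = k + 1 ∨ j = k ∨ j = k + 1 then 0
    else W (if i < k then i else i - 2) (if j < k then j else j - 2)
  | crossing k n, W, i, j =>
    if i < j then
      if i = k ∧ j = k + 1 then 0
      else if i = k + 1 then W k j + val n * W (k + 1) j
      else if j = k then W i (k + 1) + W i k * val n
      else W ((crossing k n : FrontEvent ι).follow i) ((crossing k n : FrontEvent ι).follow j)
    else 0

/-- The weighted counts to the right of a list of events. -/
noncomputable def transferList (val : ι → M) (es : List (FrontEvent ι)) (W : ℕ → ℕ → M) :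
    ℕ → ℕ → M :=
  es.foldl (fun W e => transfer val e W) W

theorem transferList_append (val : ι → M) (es fs : List (FrontEvent ι)) (W : ℕ → ℕ → M) :
    transferList val (es ++ fs) W = transferList val fs (transferList val es W) :=
  List.foldl_append

/-- When the events `es` are met with weighted counts `W` to their left, the disks with initial
vertex at any of the crossings in `es` have total weight `0`. -/
def Balanced (val : ι → M) : List (FrontEvent ι) → (ℕ → ℕ → M) → Prop
  | [], _ => True
  | leftCusp k :: es, W => Balanced val es (transfer val (leftCusp k) W)
  | crossing k n :: es, W => W k (k + 1) = 0 ∧ Balanced val es (transfer val (crossing k n) W)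

theorem Balanced.apply_eq_zero (val : ι → M) {es : List (FrontEvent ι)} {W : ℕ → ℕ → M}
    (h : Balanced val es W) {t k : ℕ} {n : ι} (ht : es[t]? = some (crossing k n)) :
    transferList val (es.take t) W k (k + 1) = 0 := by
  induction es generalizing W t with
  | nil => simp at ht
  | cons e es ih =>
    cases t with
    | zero =>
      simp only [List.getElem?_cons_zero, Option.some.injEq] at ht
      subst ht
      exact h.1
    | succ t =>
      simp only [List.getElem?_cons_succ] at ht
      simp only [List.take_succ_cons, transferList, List.foldl_cons]
      cases e with
      | leftCusp l => exact ih (W := transfer val (leftCusp l) W) h ht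
      | crossing l m => exact ih (W := transfer val (crossing l m) W) h.2 ht

end FrontEvent

namespace SimpleFront

open FrontEvent

variable {ι : Type} (F : SimpleFront ι) {M : Type} [Semiring M]

/-- The strips to the left of event `t` whose paths end in positions `i` and `j`. -/
def strips (t i j : ℕ) : Set (List (ℕ × ℕ)) :=
  {γ | F.IsStrip t γ ∧ γ.head? = some (i, j)}

theorem finite_strips (t i j : ℕ) : (F.strips t i j).Finite :=
  (F.finite_isStrip t).subset fun _ h => h.1

/-- The product of the weights of the corners of a strip, in the order in which they are read along
the boundary of a disk. -/
def weight (val : ι → M) (t : ℕ) (γ : List (ℕ × ℕ)) : M :=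
  ((F.topCorners t γ ++ F.botCorners t γ).map fun c => val c.name).prod

/-- The sum of the weights of the strips to the left of event `t` ending in positions `i`, `j`. -/
noncomputable def stripSum (val : ι → M) (t i j : ℕ) : M :=
  ∑ᶠ γ ∈ F.strips t i j, F.weight val t γ

variable {F}

theorem IsStrip.lt {t i j : ℕ} {γ : List (ℕ × ℕ)} (h : F.IsStrip t γ)
    (hγ : γ.head? = some (i, j)) : i < j := by
  cases h with
  | start t k h => simp at hγ; omega
  | step t i₀ j₀ i' j' γ h htop hbot hlt => simp at hγ; omega

theorem strips_eq_empty {t i j : ℕ} (h : ¬ i < j) : F.strips t i j = ∅ :=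
  Set.eq_empty_of_forall_notMem fun _ hγ => h (hγ.1.lt hγ.2)

theorem stripSum_eq_zero {t i j : ℕ} (val : ι → M) (h : F.strips t i j = ∅) :
    F.stripSum val t i j = 0 := by
  simp [stripSum, h]

theorem mem_strips_succ_crossing {t k : ℕ} {n : ι} (h : F.events[t]? = some (.crossing k n))
    {i' j' : ℕ} {δ : List (ℕ × ℕ)} :
    δ ∈ F.strips (t + 1) i' j' ↔ i' < j' ∧ ∃ i j, ∃ γ ∈ F.strips t i j, δ = (i', j') :: γ ∧
      (i' = (crossing k n).follow i ∨ i = k + 1 ∧ i' = k + 1) ∧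
      (j' = (crossing k n).follow j ∨ j = k ∧ j' = k) := by
  constructor
  · rintro ⟨hs, hh⟩
    refine ⟨hs.lt hh, ?_⟩
    cases hs with
    | start t l hl => simp [h] at hl
    | step t i j i₁ j₁ γ hs htop hbot hlt =>
      simp only [List.head?_cons, Option.some.injEq, Prod.mk.injEq] at hh
      obtain ⟨rfl, rfl⟩ := hh
      refine ⟨i, j, _, ⟨hs, rfl⟩, rfl, ?_, ?_⟩
      · rcases htop with ⟨e, he, h1⟩ | ⟨k', n', he, h1⟩
        · rw [h] at he; cases he; exact Or.inl h1
        · rw [h] at he; cases he; exact Or.inr h1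
      · rcases hbot with ⟨e, he, h1⟩ | ⟨k', n', he, h1⟩
        · rw [h] at he; cases he; exact Or.inl h1
        · rw [h] at he; cases he; exact Or.inr h1
  · rintro ⟨hlt, i, j, γ, ⟨hs, hh⟩, rfl, htop, hbot⟩
    refine ⟨?_, rfl⟩
    cases γ with
    | nil => simp at hh
    | cons p γ =>
      simp only [List.head?_cons, Option.some.injEq] at hh
      subst hh
      exact IsStrip.step t i j i' j' γ hs
        (htop.imp (fun h' => ⟨_, h, h'⟩) fun h' => ⟨k, n, h, h'⟩)
        (hbot.imp (fun h' => ⟨_, h, h'⟩) fun h' => ⟨k, n, h, h'⟩) hlt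

theorem crossingAt_of_crossing {t k : ℕ} {n : ι} (h : F.events[t]? = some (.crossing k n)) :
    F.crossingAt t = some ⟨t, k, n, h⟩ := by
  unfold crossingAt
  split
  · rename_i k' n' h'
    rw [h] at h'
    cases h'
    rfl
  · rename_i hn
    exact absurd h (hn k n)

theorem crossingAt_of_leftCusp {t k : ℕ} (h : F.events[t]? = some (.leftCusp k)) :
    F.crossingAt t = none := by
  unfold crossingAt
  split
  · rename_i k' n' h'
    rw [h] at h'
    cases h'
  · rfl

theorem weight_cons (val : ι → M) {t i j i' j' : ℕ} {γ : List (ℕ × ℕ)} (hγ : γ ∈ F.strips t i j) :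
    F.weight val (t + 1) ((i', j') :: γ) =
      ((F.topCornerAt t i i').map fun c => val c.name).prod * F.weight val t γ *
        ((F.botCornerAt t j j').map fun c => val c.name).prod := by
  obtain ⟨-, hh⟩ := hγ
  cases γ with
  | nil => simp at hh
  | cons p γ =>
    simp only [List.head?_cons, Option.some.injEq] at hh
    subst hh
    simp [weight, topCorners, botCorners, mul_assoc]

theorem weight_cons_crossing (val : ι → M) {t k : ℕ} {n : ι}
    (h : F.events[t]? = some (.crossing k n)) {i j i' j' : ℕ} {γ : List (ℕ × ℕ)}
    (hγ : γ ∈ F.strips t i j) :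
    F.weight val (t + 1) ((i', j') :: γ) =
      (if i = k + 1 ∧ i' = k + 1 then val n else 1) * F.weight val t γ *
        (if j = k ∧ j' = k then val n else 1) := by
  rw [weight_cons val hγ]
  congr 2
  · rw [topCornerAt, crossingAt_of_crossing h]
    split_ifs with h1 <;> simp [Option.filter, h1]
  · rw [botCornerAt, crossingAt_of_crossing h]
    split_ifs with h1 <;> simp [Option.filter, h1]

theorem weight_cons_leftCusp (val : ι → M) {t k : ℕ} (h : F.events[t]? = some (.leftCusp k))
    {i j i' j' : ℕ} {γ : List (ℕ × ℕ)} (hγ : γ ∈ F.strips t i j) :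
    F.weight val (t + 1) ((i', j') :: γ) = F.weight val t γ := by
  rw [weight_cons val hγ]
  simp [topCornerAt, botCornerAt, crossingAt_of_leftCusp h]

theorem finsum_weight_image_cons (val : ι → M) {t i j i' j' : ℕ} {α β : M}
    (h : ∀ γ ∈ F.strips t i j,
      F.weight val (t + 1) ((i', j') :: γ) = α * F.weight val t γ * β) :
    ∑ᶠ γ ∈ List.cons (i', j') '' F.strips t i j, F.weight val (t + 1) γ =
      α * F.stripSum val t i j * β := by
  rw [finsum_mem_image (List.cons_injective.injOn), finsum_mem_congr rfl h, stripSum,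
    finsum_mem_eq_finite_toFinset_sum _ (F.finite_strips t i j),
    finsum_mem_eq_finite_toFinset_sum _ (F.finite_strips t i j), Finset.mul_sum, Finset.sum_mul]

theorem disjoint_image_cons {t i j i₁ j₁ : ℕ} {p : ℕ × ℕ} (h : (i, j) ≠ (i₁, j₁)) :
    Disjoint (List.cons p '' F.strips t i j) (List.cons p '' F.strips t i₁ j₁) := by
  rw [Set.disjoint_left]
  rintro _ ⟨γ, hγ, rfl⟩ ⟨δ, hδ, he⟩
  simp only [List.cons.injEq, true_and] at he
  subst he
  exact h (Option.some.inj (hγ.2.symm.trans hδ.2))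

theorem stripSum_succ_crossing (val : ι → M) {t k : ℕ} {n : ι}
    (h : F.events[t]? = some (.crossing k n)) :
    F.stripSum val (t + 1) = transfer val (.crossing k n) (F.stripSum val t) := by
  funext i' j'
  simp only [transfer]
  have hw : ∀ i j i' j', ∀ γ ∈ F.strips t i j, F.weight val (t + 1) ((i', j') :: γ) =
      (if i = k + 1 ∧ i' = k + 1 then val n else 1) * F.weight val t γ *
        (if j = k ∧ j' = k then val n else 1) :=
    fun i j i' j' γ hγ => weight_cons_crossing val h hγ
  split_ifs with hlt h1 h2 h3
  · -- The strands which cross would have to be in the wrong order to the left of the crossing.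
    refine stripSum_eq_zero val (Set.eq_empty_of_forall_notMem fun δ hδ => ?_)
    obtain ⟨-, i, j, γ, hγ, -, h4, h5⟩ := (mem_strips_succ_crossing h).1 hδ
    have := hγ.1.lt hγ.2
    simp only [follow] at h4 h5
    split_ifs at h4 h5 <;> omega
  · subst h2
    have hset : F.strips (t + 1) (k + 1) j' = List.cons (k + 1, j') '' F.strips t k j' ∪
        List.cons (k + 1, j') '' F.strips t (k + 1) j' := by
      ext δ
      rw [mem_strips_succ_crossing h]
      constructor
      · rintro ⟨-, i, j, γ, hγ, rfl, h4, h5⟩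
        have h6 : j = j' := by
          simp only [follow] at h5
          split_ifs at h5 <;> omega
        subst h6
        have h7 : i = k ∨ i = k + 1 := by
          simp only [follow] at h4
          split_ifs at h4 <;> omega
        rcases h7 with rfl | rfl
        · exact Or.inl ⟨γ, hγ, rfl⟩
        · exact Or.inr ⟨γ, hγ, rfl⟩
      · have h5 : j' = (crossing k n).follow j' := by
          simp only [follow]
          split_ifs <;> omega
        rintro (⟨γ, hγ, rfl⟩ | ⟨γ, hγ, rfl⟩)
        · exact ⟨hlt, k, j', γ, hγ, rfl, Or.inl (by simp [follow]), Or.inl h5⟩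
        · exact ⟨hlt, k + 1, j', γ, hγ, rfl, Or.inr ⟨rfl, rfl⟩, Or.inl h5⟩
    rw [stripSum, hset, finsum_mem_union (disjoint_image_cons (by simp))
      ((F.finite_strips _ _ _).image _) ((F.finite_strips _ _ _).image _),
      finsum_weight_image_cons val (hw k j' (k + 1) j'),
      finsum_weight_image_cons val (hw (k + 1) j' (k + 1) j')]
    have : j' ≠ k := by omega
    simp [this]
  · subst h3
    have hset : F.strips (t + 1) i' j' = List.cons (i', j') '' F.strips t i' (j' + 1) ∪
        List.cons (i', j') '' F.strips t i' j' := by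
      ext δ
      rw [mem_strips_succ_crossing h]
      constructor
      · rintro ⟨-, i, j, γ, hγ, rfl, h4, h5⟩
        have h6 : i = i' := by
          simp only [follow] at h4
          split_ifs at h4 <;> omega
        subst h6
        have h7 : j = j' + 1 ∨ j = j' := by
          simp only [follow] at h5
          split_ifs at h5 <;> omega
        rcases h7 with rfl | rfl
        · exact Or.inl ⟨γ, hγ, rfl⟩
        · exact Or.inr ⟨γ, hγ, rfl⟩
      · have h5 : i' = (crossing j' n).follow i' := by
          simp only [follow]
          split_ifs <;> omega
        rintro (⟨γ, hγ, rfl⟩ | ⟨γ, hγ, rfl⟩)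
        · exact ⟨hlt, i', j' + 1, γ, hγ, rfl, Or.inl h5, Or.inl (by simp [follow])⟩
        · exact ⟨hlt, i', j', γ, hγ, rfl, Or.inl h5, Or.inr ⟨rfl, rfl⟩⟩
    rw [stripSum, hset, finsum_mem_union (disjoint_image_cons (by simp))
      ((F.finite_strips _ _ _).image _) ((F.finite_strips _ _ _).image _),
      finsum_weight_image_cons val (hw i' (j' + 1) i' j'),
      finsum_weight_image_cons val (hw i' j' i' j')]
    simp [h2]
  · have hset : F.strips (t + 1) i' j' = List.cons (i', j') ''
        F.strips t ((crossing k n).follow i') ((crossing k n).follow j') := by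
      ext δ
      rw [mem_strips_succ_crossing h]
      constructor
      · rintro ⟨-, i, j, γ, hγ, rfl, h4, h5⟩
        have h6 : i = (crossing k n).follow i' := by
          simp only [follow] at h4 ⊢
          split_ifs at h4 ⊢ <;> omega
        have h7 : j = (crossing k n).follow j' := by
          simp only [follow] at h5 ⊢
          split_ifs at h5 ⊢ <;> omega
        subst h6 h7
        exact ⟨γ, hγ, rfl⟩
      · rintro ⟨γ, hγ, rfl⟩
        refine ⟨hlt, _, _, γ, hγ, rfl, Or.inl ?_, Or.inl ?_⟩ <;>
        · simp only [follow]
          split_ifs <;> omega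
    rw [stripSum, hset, finsum_weight_image_cons val (hw _ _ i' j')]
    simp [h2, h3]
  · exact stripSum_eq_zero val (strips_eq_empty hlt)

theorem mem_strips_succ_leftCusp {t k : ℕ} (h : F.events[t]? = some (.leftCusp k))
    {i' j' : ℕ} {δ : List (ℕ × ℕ)} :
    δ ∈ F.strips (t + 1) i' j' ↔ (i' = k ∧ j' = k + 1 ∧ δ = [(k, k + 1)]) ∨
      ∃ i j, ∃ γ ∈ F.strips t i j, δ = (i', j') :: γ ∧
      i' = (leftCusp k : FrontEvent ι).follow i ∧ j' = (leftCusp k : FrontEvent ι).follow j := by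
  constructor
  · rintro ⟨hs, hh⟩
    cases hs with
    | start t l hl =>
      rw [h] at hl; cases hl
      simp only [List.head?_cons, Option.some.injEq, Prod.mk.injEq] at hh
      exact Or.inl ⟨hh.1.symm, hh.2.symm, rfl⟩
    | step t i j i₁ j₁ γ hs htop hbot hlt =>
      simp only [List.head?_cons, Option.some.injEq, Prod.mk.injEq] at hh
      obtain ⟨rfl, rfl⟩ := hh
      refine Or.inr ⟨i, j, _, ⟨hs, rfl⟩, rfl, ?_, ?_⟩
      · rcases htop with ⟨e, he, h1⟩ | ⟨k', n', he, h1⟩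
        · rw [h] at he; cases he; exact h1
        · rw [h] at he; cases he
      · rcases hbot with ⟨e, he, h1⟩ | ⟨k', n', he, h1⟩
        · rw [h] at he; cases he; exact h1
        · rw [h] at he; cases he
  · rintro (⟨rfl, rfl, rfl⟩ | ⟨i, j, γ, ⟨hs, hh⟩, rfl, htop, hbot⟩)
    · exact ⟨IsStrip.start t _ h, rfl⟩
    · refine ⟨?_, rfl⟩
      have hlt := hs.lt hh
      cases γ with
      | nil => simp at hh
      | cons p γ =>
        simp only [List.head?_cons, Option.some.injEq] at hh
        subst hh
        refine IsStrip.step t i j i' j' γ hs (Or.inl ⟨_, h, htop⟩) (Or.inl ⟨_, h, hbot⟩) ?_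
        simp only [follow] at htop hbot
        split_ifs at htop hbot <;> omega

theorem stripSum_succ_leftCusp (val : ι → M) {t k : ℕ} (h : F.events[t]? = some (.leftCusp k)) :
    F.stripSum val (t + 1) = transfer val (.leftCusp k) (F.stripSum val t) := by
  funext i' j'
  simp only [transfer]
  have hne : ∀ i, (leftCusp k : FrontEvent ι).follow i ≠ k ∧
      (leftCusp k : FrontEvent ι).follow i ≠ k + 1 := by
    intro i
    simp only [follow]
    split_ifs <;> omega
  by_cases h1 : i' = k ∧ j' = k + 1
  · rw [if_pos h1]
    obtain ⟨rfl, rfl⟩ := h1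
    have hset : F.strips (t + 1) i' (i' + 1) = {[(i', i' + 1)]} := by
      ext δ
      rw [mem_strips_succ_leftCusp h, Set.mem_singleton_iff]
      constructor
      · rintro (⟨-, -, rfl⟩ | ⟨i, j, γ, -, -, h4, -⟩)
        · rfl
        · exact absurd h4.symm (hne i).1
      · rintro rfl
        exact Or.inl ⟨rfl, rfl, rfl⟩
    rw [stripSum, hset, finsum_mem_singleton]
    simp [weight, topCorners, botCorners]
  rw [if_neg h1]
  by_cases h2 : i' = k ∨ i' = k + 1 ∨ j' = k ∨ j' = k + 1
  · rw [if_pos h2]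
    refine stripSum_eq_zero val (Set.eq_empty_of_forall_notMem fun δ hδ => ?_)
    rcases (mem_strips_succ_leftCusp h).1 hδ with ⟨h4, h5, -⟩ | ⟨i, j, γ, -, -, h4, h5⟩
    · exact h1 ⟨h4, h5⟩
    · have := hne i
      have := hne j
      omega
  · rw [if_neg h2]
    have hset : F.strips (t + 1) i' j' = List.cons (i', j') ''
        F.strips t (if i' < k then i' else i' - 2) (if j' < k then j' else j' - 2) := by
      ext δ
      rw [mem_strips_succ_leftCusp h]
      constructor
      · rintro (⟨h4, h5, -⟩ | ⟨i, j, γ, hγ, rfl, h4, h5⟩)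
        · omega
        · refine ⟨γ, ?_, rfl⟩
          have h6 : (if i' < k then i' else i' - 2) = i := by
            simp only [follow] at h4
            split_ifs at h4 ⊢ <;> omega
          have h7 : (if j' < k then j' else j' - 2) = j := by
            simp only [follow] at h5
            split_ifs at h5 ⊢ <;> omega
          rwa [h6, h7]
      · rintro ⟨γ, hγ, rfl⟩
        refine Or.inr ⟨_, _, γ, hγ, rfl, ?_, ?_⟩ <;>
        · simp only [follow]
          split_ifs <;> omega
    rw [stripSum, hset, finsum_weight_image_cons val (α := 1) (β := 1)
      fun γ hγ => by rw [weight_cons_leftCusp val h hγ, one_mul, mul_one]]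
    rw [one_mul, mul_one]

/-- The weighted strip counts are computed by sweeping the front from left to right. -/
theorem stripSum_eq_transferList (val : ι → M) {t : ℕ} (ht : t ≤ F.events.length) :
    F.stripSum val t = transferList val (F.events.take t) 0 := by
  induction t with
  | zero =>
    funext i j
    refine stripSum_eq_zero val (Set.eq_empty_of_forall_notMem fun γ hγ => ?_)
    have := hγ.1
    cases this
  | succ t ih =>
    have hlt : t < F.events.length := ht
    have he : F.events[t]? = some F.events[t] := List.getElem?_eq_getElem hlt
    rw [List.take_succ_eq_append_getElem hlt, transferList_append, ← ih hlt.le]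
    simp only [transferList, List.foldl_cons, List.foldl_nil]
    cases hc : F.events[t] with
    | leftCusp k => exact stripSum_succ_leftCusp val (he.trans (by rw [hc]))
    | crossing k n => exact stripSum_succ_crossing val (he.trans (by rw [hc]))

/-! ### The differential and the characteristic algebra -/

section Algebra

variable {A : Type} [Semiring A] [Algebra (ZMod 2) A]

theorem map_sum_word (val : ι → A) (f : F.Ch →ₐ[ZMod 2] A)
    (hf : ∀ c : F.Crossing, f (FreeAlgebra.ι (ZMod 2) (Sum.inl c)) = val c.name)
    (v : F.Generator) :
    f (∑ γ ∈ (F.finite_disks v).toFinset, F.word v γ) =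
      F.stripSum val (F.slice v) (F.height v) (F.height v + 1) := by
  rw [map_sum, stripSum, finsum_mem_eq_finite_toFinset_sum _ (F.finite_strips _ _ _)]
  refine Finset.sum_congr rfl fun γ _ => ?_
  simp [word, weight, map_list_prod, hf, Function.comp_def]

/-- A homomorphism kills the differentials of all generators as soon as the total weight of the
disks is `0` at every crossing and `1` at every right cusp. -/
theorem map_dGen_eq_zero (val : ι → A) (f : F.Ch →ₐ[ZMod 2] A)
    (hf : ∀ c : F.Crossing, f (FreeAlgebra.ι (ZMod 2) (Sum.inl c)) = val c.name)
    (hbal : Balanced val F.events 0)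
    (hcusp : ∀ i < cusps F.events, transferList val F.events 0 (2 * i) (2 * i + 1) = 1)
    (v : F.Generator) : f (F.dGen v) = 0 := by
  rw [dGen.eq_def, map_add, map_sum_word val f hf]
  cases v with
  | inl c =>
    have hlt : c.index < F.events.length :=
      (List.getElem?_eq_some_iff.1 c.isCrossing).1
    simp only [slice, height, map_zero, zero_add]
    rw [stripSum_eq_transferList val hlt.le]
    exact hbal.apply_eq_zero val c.isCrossing
  | inr i =>
    simp only [slice, height, map_one]
    rw [stripSum_eq_transferList val le_rfl, List.take_length, hcusp i i.2]
    have h2 : algebraMap (ZMod 2) A (1 + 1) = 0 := by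
      rw [show (1 + 1 : ZMod 2) = 0 by decide, map_zero]
    simpa using h2

theorem map_d_eq_zero (f : F.Ch →ₐ[ZMod 2] A) (hf : ∀ v : F.Generator, f (F.dGen v) = 0)
    (x : F.Ch) : f (F.d x) = 0 := by
  induction x using FreeAlgebra.induction with
  | grade0 r =>
    rw [d, AlgHom.commutes, TrivSqZeroExt.algebraMap_eq_inl', TrivSqZeroExt.snd_inl, map_zero]
  | grade1 v => rw [d_ι, hf]
  | mul x y hx hy => simp [d_mul, hx, hy]
  | add x y hx hy => simp [d_add, hx, hy]

theorem existsUnique_charAlg_hom {A : Type} [Ring A] [Algebra (ZMod 2) A]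
    (f : F.Ch →ₐ[ZMod 2] A) (hf : ∀ x : F.Ch, f (F.d x) = 0) :
    ∃! φ : F.CharAlg →ₐ[ZMod 2] A, ∀ x : F.Ch, φ (F.toCharAlg x) = f x := by
  have hle : TwoSidedIdeal.span (Set.range F.d) ≤ TwoSidedIdeal.ker f := by
    rw [TwoSidedIdeal.span_le]
    rintro _ ⟨x, rfl⟩
    exact (TwoSidedIdeal.mem_ker f).2 (hf x)
  have hker : (TwoSidedIdeal.span (Set.range F.d)).ringCon ≤ RingCon.ker (f : F.Ch →+* A) := by
    intro x y hxy
    have h1 := (TwoSidedIdeal.mem_ker f).1 (hle ((TwoSidedIdeal.rel_iff _ x y).1 hxy))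
    rw [map_sub, sub_eq_zero] at h1
    exact h1
  refine ⟨RingCon.liftₐ _ f hker, fun x => rfl, fun ψ hψ => ?_⟩
  refine AlgHom.ext fun y => ?_
  induction y using Quotient.inductionOn with
  | h x => exact hψ x

end Algebra

end SimpleFront

/-! ### Sweeping a list of events with an invariant -/

namespace FrontEvent

variable {ι : Type} {M : Type} [Semiring M]

/-- Weighted counts satisfying `P` are carried by the events `es` to counts satisfying `Q`, and the
disks with initial vertex at a crossing of `es` have total weight `0`. -/
def Sweeps (val : ι → M) (P : (ℕ → ℕ → M) → Prop) (es : List (FrontEvent ι))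
    (Q : (ℕ → ℕ → M) → Prop) : Prop :=
  ∀ W, P W → Balanced val es W ∧ Q (transferList val es W)

namespace Sweeps

variable {val : ι → M} {P Q R : (ℕ → ℕ → M) → Prop}

theorem nil (h : ∀ W, P W → Q W) : Sweeps val P [] Q :=
  fun W hW => ⟨trivial, h W hW⟩

theorem leftCusp {k : ℕ} (h : ∀ W, P W → Q (transfer val (.leftCusp k) W)) :
    Sweeps val P [.leftCusp k] Q :=
  fun W hW => ⟨trivial, h W hW⟩

theorem crossing {k : ℕ} {n : ι}
    (h : ∀ W, P W → W k (k + 1) = 0 ∧ Q (transfer val (.crossing k n) W)) :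
    Sweeps val P [.crossing k n] Q :=
  fun W hW => ⟨⟨(h W hW).1, trivial⟩, (h W hW).2⟩

theorem append {es fs : List (FrontEvent ι)} (h₁ : Sweeps val P es Q) (h₂ : Sweeps val Q fs R) :
    Sweeps val P (es ++ fs) R := by
  have hbal : ∀ W, Balanced val es W → Balanced val fs (transferList val es W) →
      Balanced val (es ++ fs) W := by
    clear h₁ h₂
    induction es with
    | nil => exact fun W _ h => h
    | cons e es ih =>
      cases e with
      | leftCusp k => exact fun W h h' => ih _ h h'
      | crossing k n => exact fun W h h' => ⟨h.1, ih _ h.2 h'⟩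
  intro W hW
  obtain ⟨h3, h4⟩ := h₁ W hW
  obtain ⟨h5, h6⟩ := h₂ _ h4
  rw [transferList_append]
  exact ⟨hbal W h3 h5, h6⟩

theorem imp {es : List (FrontEvent ι)} {P' Q' : (ℕ → ℕ → M) → Prop} (h : Sweeps val P es Q)
    (hP : ∀ W, P' W → P W) (hQ : ∀ W, Q W → Q' W) : Sweeps val P' es Q' :=
  fun W hW => ⟨(h W (hP W hW)).1, hQ _ (h W (hP W hW)).2⟩

theorem map_range {K : ℕ → (ℕ → ℕ → M) → Prop} {e : ℕ → FrontEvent ι} (n : ℕ)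
    (h : ∀ k < n, Sweeps val (K k) [e k] (K (k + 1))) :
    Sweeps val (K 0) ((List.range n).map e) (K n) := by
  induction n with
  | zero => exact nil fun _ h => h
  | succ n ih =>
    rw [List.range_succ, List.map_append]
    exact (ih fun k hk => h k (by omega)).append (h n (by omega))

theorem flatMap_range' {K : ℕ → (ℕ → ℕ → M) → Prop} {g : ℕ → List (FrontEvent ι)} (n : ℕ)
    (h : ∀ k < n, Sweeps val (K k) (g (k + 1)) (K (k + 1))) :
    Sweeps val (K 0) ((List.range' 1 n).flatMap g) (K n) := by
  induction n with
  | zero => exact nil fun _ h => h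
  | succ n ih =>
    rw [List.range'_concat, List.flatMap_append]
    refine (ih fun k hk => h k (by omega)).append ?_
    simpa [add_comm] using h n (by omega)

theorem map_reverse_range' {K : ℕ → (ℕ → ℕ → M) → Prop} {e : ℕ → FrontEvent ι} (s n : ℕ)
    (h : ∀ m, s ≤ m → m < s + n → Sweeps val (K (m + 1)) [e (m + 1)] (K m)) :
    Sweeps val (K (s + n)) ((List.range' (s + 1) n).reverse.map e) (K s) := by
  induction n with
  | zero => exact nil fun _ h => h
  | succ n ih =>
    rw [List.range'_concat, List.reverse_append, List.map_append]
    refine append ?_ (ih fun k hk hk' => h k hk (by omega))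
    simpa [add_comm, add_left_comm, add_assoc] using h (s + n) (by omega) (by omega)

end Sweeps

end FrontEvent

/-! ### Weighted counts in terms of labelled strands -/

section Strands

open FrontEvent

variable {ι : Type} {M : Type} {S S' : Type}

/-- The strands over some abscissa are labelled by the elements of `S` which satisfy `alive`, and
`pos` gives their positions.  `V x y` is the weighted count of the strips with upper path on `x` and
lower path on `y` whenever `x` is above `y`; the other entries of `V` are arbitrary. -/
def Describes (alive : S → Prop) (pos : S → ℕ) (V : S → S → M) (W : ℕ → ℕ → M) : Prop :=
  ∀ x y, alive x → alive y → pos x < pos y → W (pos x) (pos y) = V x y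

namespace Describes

variable {alive : S → Prop} {pos : S → ℕ} {V : S → S → M} {W : ℕ → ℕ → M}

theorem relabel (h : Describes alive pos V W) {alive' : S' → Prop} {pos' : S' → ℕ}
    {V' : S' → S' → M} (φ : S' → S) (halive : ∀ x, alive' x → alive (φ x))
    (hpos : ∀ x, alive' x → pos' x = pos (φ x))
    (hV : ∀ x y, alive' x → alive' y → V' x y = V (φ x) (φ y)) :
    Describes alive' pos' V' W := by
  intro x y hx hy hxy
  rw [hpos x hx, hpos y hy] at hxy
  rw [hpos x hx, hpos y hy, hV x y hx hy]
  exact h _ _ (halive x hx) (halive y hy) hxy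

theorem congr (h : Describes alive pos V W) {V' : S → S → M} {pos' : S → ℕ}
    (hpos : ∀ x, alive x → pos' x = pos x)
    (hV : ∀ x y, alive x → alive y → V' x y = V x y) : Describes alive pos' V' W :=
  h.relabel id (fun _ hx => hx) hpos hV

variable [Semiring M]

/-- A left cusp adds a pair of strands `s`, `t` joined by one strip. -/
theorem leftCusp (h : Describes alive pos V W) (val : ι → M) {k : ℕ} {s t : S}
    {alive' : S → Prop} {pos' : S → ℕ} {V' : S → S → M}
    (halive : ∀ x, alive' x → x = s ∨ x = t ∨ alive x)
    (hs : pos' s = k) (ht : pos' t = k + 1)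
    (hpos : ∀ x, alive x → pos' x = (FrontEvent.leftCusp k : FrontEvent ι).follow (pos x))
    (hst : V' s t = 1) (hV : ∀ x y, alive x → alive y → V' x y = V x y)
    (hsx : ∀ x, alive x → V' s x = 0 ∧ V' x s = 0 ∧ V' t x = 0 ∧ V' x t = 0) :
    Describes alive' pos' V' (transfer val (.leftCusp k) W) := by
  have hne : ∀ x, alive x → pos' x ≠ k ∧ pos' x ≠ k + 1 ∧
      (if pos' x < k then pos' x else pos' x - 2) = pos x := by
    intro x hx
    rw [hpos x hx]
    simp only [follow]
    split_ifs <;> omega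
  intro x y hx hy hxy
  simp only [transfer]
  rcases halive x hx with rfl | rfl | hx <;> rcases halive y hy with rfl | rfl | hy
  · omega
  · simp [hs, ht, hst]
  · have := hne y hy
    simp [hs, this, hsx y hy]
  · omega
  · omega
  · have := hne y hy
    simp [ht, this, hsx y hy]
  · have := hne x hx
    simp [hs, this, hsx x hx]
  · have := hne x hx
    simp [ht, this, hsx x hx]
  · obtain ⟨h1, h2, h3⟩ := hne x hx
    obtain ⟨h4, h5, h6⟩ := hne y hy
    rw [if_neg (by omega), if_neg (by omega), h3, h6, hV x y hx hy]
    refine h x y hx hy ?_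
    rw [hpos x hx, hpos y hy] at hxy
    simp only [follow] at hxy
    split_ifs at hxy <;> omega

/-- At a crossing of `s` (coming from above) and `t` (coming from below) the strips gain those which
have a corner there: an upper path may change from `t` to `s`, and a lower path from `s` to `t`. -/
theorem crossing [DecidableEq S] (h : Describes alive pos V W) (val : ι → M) {k : ℕ} {n : ι}
    {s t : S} {pos' : S → ℕ} (halive_s : alive s) (halive_t : alive t)
    (hs : pos s = k) (ht : pos t = k + 1)
    (hinj : ∀ x y, alive x → alive y → pos x = pos y → x = y)
    (hpos : ∀ x, alive x → pos' x = (FrontEvent.crossing k n : FrontEvent ι).follow (pos x))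
    (hts : V t s = 0) :
    Describes alive pos' (fun x y => V x y + (if x = s then val n * V t y else 0) +
      (if y = t then V x s * val n else 0)) (transfer val (.crossing k n) W) := by
  have hst : s ≠ t := by
    rintro rfl
    omega
  have hs' : pos' s = k + 1 := by rw [hpos s halive_s]; simp [follow, hs]
  have ht' : pos' t = k := by rw [hpos t halive_t]; simp [follow, ht]
  have hne : ∀ x, alive x → x ≠ s → x ≠ t → pos x ≠ k ∧ pos x ≠ k + 1 ∧ pos' x = pos x := by
    intro x hx hxs hxt
    have h1 : pos x ≠ k := fun h => hxs (hinj x s hx halive_s (h.trans hs.symm))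
    have h2 : pos x ≠ k + 1 := fun h => hxt (hinj x t hx halive_t (h.trans ht.symm))
    rw [hpos x hx]
    simp [follow, h1, h2]
  intro x y hx hy hxy
  simp only [transfer, if_pos hxy]
  by_cases hxs : x = s
  · subst hxs
    have hys : y ≠ x := by rintro rfl; omega
    have hyt : y ≠ t := by rintro rfl; omega
    obtain ⟨h1, h2, h3⟩ := hne y hy hys hyt
    rw [hs', h3]
    rw [if_neg (by omega), if_pos rfl]
    simp only [if_true, if_neg hyt, add_zero]
    rw [← h x y hx hy (by omega), ← h t y halive_t hy (by omega), hs, ht]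
  by_cases hyt : y = t
  · subst hyt
    have hxt : x ≠ y := by rintro rfl; omega
    obtain ⟨h1, h2, h3⟩ := hne x hx hxs hxt
    rw [ht', h3]
    rw [if_neg (by omega), if_neg (by omega), if_pos rfl]
    simp only [if_true, if_neg hxs, add_zero]
    rw [← h x y hx hy (by omega), ← h x s hx halive_s (by omega), hs, ht]
  simp only [if_neg hxs, if_neg hyt, add_zero]
  by_cases hxt : x = t
  · subst hxt
    by_cases hys : y = s
    · subst hys
      rw [if_pos ⟨ht', hs'⟩, hts]
    · obtain ⟨h1, h2, h3⟩ := hne y hy hys hyt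
      rw [ht', h3]
      rw [if_neg (by omega), if_neg (by omega), if_neg h1, ← h x y hx hy (by omega), ht]
      simp [follow, h1, h2]
  · obtain ⟨h1, h2, h3⟩ := hne x hx hxs hxt
    by_cases hys : y = s
    · subst hys
      rw [hs', h3]
      rw [if_neg (by omega), if_neg h2, if_neg (by omega), ← h x y hx hy (by omega), hs]
      simp [follow, h1, h2]
    · obtain ⟨h4, h5, h6⟩ := hne y hy hys hyt
      rw [h3, h6]
      rw [if_neg (by omega), if_neg h2, if_neg h4, ← h x y hx hy (by omega)]
      simp [follow, h1, h2, h4, h5]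

end Describes

end Strands

/-! ### The left half of the torus front -/

section Torus

open FrontEvent

/-- Labels for the strands of a half of the torus front: the `i`-th upper and the `i`-th lower strand
at the cusps on the outer side of that half. -/
inductive Strand where
  | upper (i : ℕ)
  | lower (i : ℕ)
  deriving DecidableEq

namespace Strand

/-- The number of the cusp. -/
def idx : Strand → ℕ
  | upper i => i
  | lower i => i

/-- The strand belongs to one of the cusps `1, …, n`. -/
def Within (n : ℕ) (s : Strand) : Prop := 1 ≤ s.idx ∧ s.idx ≤ n

end Strand

open Strand

theorem eq_follow_leftCusp_iff {ι : Type} {k m m' : ℕ} :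
    m' = (leftCusp k : FrontEvent ι).follow m ↔ m < k ∧ m' = m ∨ k ≤ m ∧ m' = m + 2 := by
  simp only [follow]
  split_ifs <;> omega

theorem eq_follow_crossing_iff {ι : Type} {k m m' : ℕ} {n : ι} :
    m' = (crossing k n).follow m ↔
      (m = k → m' = k + 1) ∧ (m = k + 1 → m' = k) ∧ (m ≠ k → m ≠ k + 1 → m' = m) := by
  simp only [follow]
  split_ifs <;> omega

variable {M : Type} [Semiring M]

/-- The values of the representation on the crossings. -/
def torusVal (p : ℕ) (a b : M) : TorusCrossing → M
  | .x i j => if j = i + 1 then a else if i = 1 ∧ j = p then b else 0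
  | .y i j => if j + 1 = i + p then a else if j = i + 1 then b else 0

/-- The square of the matrix of the values of the `x i j` is zero. -/
theorem torusVal_x_mul_x {p : ℕ} (hp : 3 ≤ p) {a : M} (b : M) (ha : a * a = 0) {i k j : ℕ}
    (hi : 1 ≤ i) (hj : j ≤ p) :
    torusVal p a b (.x i k) * torusVal p a b (.x k j) = 0 := by
  simp only [torusVal]
  split_ifs <;> first | (exfalso; omega) | simp [ha]

/-- The positions of the strands after the outer left cusps. -/
def outerPos : Strand → ℕ
  | upper m => 2 * m - 2
  | lower m => 2 * m - 1

/-- Only the two strands of the same cusp bound a strip. -/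
def cuspMatrix : Strand → Strand → M
  | upper m, lower n => if m = n then 1 else 0
  | _, _ => 0

theorem sweeps_torusOuterCusps (val : TorusCrossing → M) (p : ℕ) :
    Sweeps val (fun W => W = 0) (torusOuterCusps p)
      (Describes (Within p) outerPos cuspMatrix) := by
  refine (Sweeps.map_range (K := fun n => Describes (Within n) outerPos cuspMatrix) p
    fun k _ => Sweeps.leftCusp fun W hW => ?_).imp ?_ fun _ h => h
  · refine hW.leftCusp val (s := upper (k + 1)) (t := lower (k + 1)) ?_ ?_ ?_ ?_ ?_ ?_ ?_
    · rintro (m | m) ⟨h1, h2⟩ <;> simp only [idx, Within] at h1 h2 ⊢ <;> grind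
    · simp only [outerPos]; omega
    · simp only [outerPos]; omega
    · rintro (m | m) ⟨h1, h2⟩ <;> rw [eq_follow_leftCusp_iff] <;>
        simp only [idx, outerPos, and_true] at * <;> omega
    · simp [cuspMatrix]
    · exact fun _ _ _ _ => rfl
    · rintro (m | m) ⟨h1, h2⟩ <;> simp only [idx] at h1 h2 <;> simp [cuspMatrix] <;> omega
  · rintro W rfl (m | m) y ⟨h1, h2⟩ <;> simp only [idx] at h1 h2 <;> omega

/-- The positions of the strands in the left half to the left of the crossing `x i j`. -/
def leftPos (i j : ℕ) : Strand → ℕ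
  | upper m => if m < j then m - 1 else if m = j then i + j - 1 else 2 * m - 2
  | lower m => if m < j then (if m ≤ i then j + m - 2 else j + m - 1) else 2 * m - 1

/-- The counts to the left of the crossing `x i j`: the product `u * c * u` of the matrix `c` of the
cusps and the unipotent matrix `u` whose lower left block holds the values of those crossings
`x m n` which have been passed, that is `n < j ∨ n = j ∧ i < m`.  The entries of the lower left block
of the product are sums of products of two such values, hence zero. -/
noncomputable def leftMatrix (p : ℕ) (a b : M) (i j : ℕ) : Strand → Strand → M
  | upper m, upper n => if n < j ∨ n = j ∧ i < m then torusVal p a b (.x m n) else 0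
  | upper m, lower n => if m = n then 1 else 0
  | lower m, lower n => if n < j ∨ n = j ∧ i < m then torusVal p a b (.x m n) else 0
  | lower _, upper _ => 0

/-- At `x i j` the strips with upper path on the lower strand `i` and lower path on the upper strand
`j` have total weight `∑ k, x i k * x k j`, whose terms are zero for the chosen values. -/
theorem sweeps_x {p : ℕ} (hp : 3 ≤ p) {a : M} (b : M) (ha : a * a = 0) {i j : ℕ} (hi : 1 ≤ i)
    (hij : i < j) (hj : j ≤ p) :
    Sweeps (torusVal p a b)
      (Describes (Within p) (leftPos i j) (leftMatrix p a b i j))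
      [.crossing (i + j - 2) (.x i j)]
      (Describes (Within p) (leftPos (i - 1) j) (leftMatrix p a b (i - 1) j)) := by
  refine Sweeps.crossing fun W hW => ⟨?_, ?_⟩
  · have := hW (lower i) (upper j) ⟨hi, by simp only [idx]; omega⟩ ⟨by simp only [idx]; omega, hj⟩
      (by simp only [leftPos]; split_ifs <;> omega)
    rw [leftMatrix] at this
    convert this using 1
    congr 1 <;> simp only [leftPos] <;> split_ifs <;> omega
  · have key := hW.crossing (torusVal p a b) (k := i + j - 2) (n := .x i j) (s := lower i)
      (t := upper j) (pos' := leftPos (i - 1) j) ⟨hi, by simp only [idx]; omega⟩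
      ⟨by simp only [idx]; omega, hj⟩ (by simp only [leftPos]; split_ifs <;> omega)
      (by simp only [leftPos]; split_ifs <;> omega)
      (by
        rintro (m | m) (n | n) ⟨h1, h2⟩ ⟨h3, h4⟩ h5 <;>
          simp only [leftPos, idx, upper.injEq, lower.injEq, reduceCtorEq] at * <;>
          split_ifs at h5 <;> omega)
      (by
        rintro (m | m) ⟨h1, h2⟩ <;> rw [eq_follow_crossing_iff] <;>
          simp only [idx, leftPos] at * <;> split_ifs <;> omega)
      (by simp only [leftMatrix]; rw [if_neg (by omega)])
    refine key.congr (fun _ _ => rfl) ?_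
    rintro (m | m) (n | n) ⟨h1, h2⟩ ⟨h3, h4⟩ <;>
      simp only [leftMatrix, idx, upper.injEq, lower.injEq, reduceCtorEq, if_false, add_zero,
        zero_add] at *
    · by_cases h5 : m = i ∧ n = j
      · obtain ⟨rfl, rfl⟩ := h5
        rw [if_pos (by omega), if_neg (by omega), if_pos rfl, if_pos rfl, zero_add, one_mul]
      · split_ifs <;> first | (exfalso; omega) | simp
    · have hx := torusVal_x_mul_x hp b ha (i := i) (k := j) hi h4
      have hx' := torusVal_x_mul_x hp b ha (i := m) (k := i) h1 hj
      split_ifs <;> subst_vars <;> simp [hx, hx']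
    · by_cases h5 : m = i ∧ n = j
      · obtain ⟨rfl, rfl⟩ := h5
        rw [if_pos (by omega), if_neg (by omega), if_pos rfl, if_pos rfl, zero_add, mul_one]
      · split_ifs <;> first | (exfalso; omega) | simp

theorem sweeps_torusLeft {p : ℕ} (hp : 3 ≤ p) {a : M} (b : M) (ha : a * a = 0) :
    Sweeps (torusVal p a b) (Describes (Within p) outerPos cuspMatrix) (torusLeft p)
      (Describes (Within p) (leftPos p (p + 1)) (leftMatrix p a b p (p + 1))) := by
  refine (Sweeps.flatMap_range' (K := fun j => Describes (Within p) (leftPos j (j + 1))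
    (leftMatrix p a b j (j + 1))) p fun k hk => ?_).imp ?_ fun _ h => h
  · have h := Sweeps.map_reverse_range' (val := torusVal p a b)
      (K := fun i => Describes (Within p) (leftPos i (k + 1))
        (leftMatrix p a b i (k + 1)))
      (e := fun i => .crossing (i + (k + 1) - 2) (.x i (k + 1))) 0 k
      fun m _ hm => sweeps_x hp b ha (i := m + 1) (by omega) (by omega) (by omega)
    rw [zero_add] at h
    refine h.imp (fun _ h => h) fun W hW => hW.congr ?_ ?_
    · rintro (m | m) ⟨h1, h2⟩ <;> simp only [idx, leftPos] at * <;> split_ifs <;> omega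
    · rintro (m | m) (n | n) ⟨h1, h2⟩ ⟨h3, h4⟩ <;>
        simp only [idx, leftMatrix, torusVal] at * <;>
        split_ifs <;> first | rfl | (exfalso; omega)
  · refine fun W hW => hW.congr ?_ ?_
    · rintro (m | m) ⟨h1, h2⟩ <;> simp only [idx, outerPos, leftPos] at * <;> split_ifs <;> omega
    · rintro (m | m) (n | n) ⟨h1, h2⟩ ⟨h3, h4⟩ <;>
        simp only [idx, leftMatrix, cuspMatrix, torusVal] at * <;>
        split_ifs <;> first | rfl | (exfalso; omega)

/-! ### The inner left cusps -/

/-- The strands after the left half (`Sum.inl`) and those starting at the inner cusps (`Sum.inr`),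
when `n` inner cusps have been passed. -/
def innerWithin (p n : ℕ) : Strand ⊕ Strand → Prop
  | .inl s => s.Within p
  | .inr s => s.Within n

/-- The positions of the strands when `n` inner cusps have been passed. -/
def innerPos (p n : ℕ) : Strand ⊕ Strand → ℕ
  | .inl (upper m) => m - 1
  | .inl (lower m) => p + 2 * n + m - 1
  | .inr (upper m) => p + 2 * m - 2
  | .inr (lower m) => p + 2 * m - 1

/-- The block diagonal matrix of the counts after the left half and those at the inner cusps. -/
noncomputable def innerMatrix (p : ℕ) (a b : M) : Strand ⊕ Strand → Strand ⊕ Strand → M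
  | .inl s, .inl t => leftMatrix p a b p (p + 1) s t
  | .inr s, .inr t => cuspMatrix s t
  | _, _ => 0

theorem sweeps_torusInnerCusps (val : TorusCrossing → M) (p q : ℕ) (a b : M) :
    Sweeps val (Describes (Within p) (leftPos p (p + 1)) (leftMatrix p a b p (p + 1)))
      (torusInnerCusps p q)
      (Describes (innerWithin p (q - p)) (innerPos p (q - p)) (innerMatrix p a b)) := by
  refine (Sweeps.map_range (K := fun n => Describes (innerWithin p n) (innerPos p n)
    (innerMatrix p a b)) (q - p) fun k _ => Sweeps.leftCusp fun W hW => ?_).imp ?_ fun _ h => h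
  · refine hW.leftCusp val (s := .inr (upper (k + 1))) (t := .inr (lower (k + 1)))
      ?_ ?_ ?_ ?_ ?_ ?_ ?_
    · rintro (s | (m | m)) h
      · exact Or.inr (Or.inr h)
      all_goals
        obtain ⟨h1, h2⟩ := h
        simp only [idx, innerWithin, Within] at h1 h2 ⊢
        grind
    · simp only [innerPos]; omega
    · simp only [innerPos]; omega
    · rintro ((m | m) | (m | m)) ⟨h1, h2⟩ <;> rw [eq_follow_leftCusp_iff] <;>
        simp only [idx, innerPos, and_true] at * <;> omega
    · simp [innerMatrix, cuspMatrix]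
    · exact fun _ _ _ _ => rfl
    · rintro ((m | m) | (m | m)) ⟨h1, h2⟩ <;> simp only [idx] at h1 h2 <;>
        simp [innerMatrix, cuspMatrix] <;> omega
  · refine fun W hW => hW.relabel (Sum.elim id id) ?_ ?_ ?_
    · rintro (s | s) h
      · exact h
      · obtain ⟨h1, h2⟩ := h
        omega
    · rintro ((m | m) | (m | m)) ⟨h1, h2⟩ <;> simp [innerPos, leftPos, idx] at * <;>
        grind
    · rintro (s | s) (t | t) h h'
      · rfl
      all_goals
        obtain ⟨h1, h2⟩ := h
        obtain ⟨h3, h4⟩ := h'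
        omega

/-! ### The right half of the torus front -/

/-- The positions of the strands in the right half to the left of the crossing `y i j`: the lower
strand `i` has passed the upper strands `j + 1, …, min q (i + p - 1)`. -/
def rightPos (p q i j : ℕ) : Strand → ℕ
  | upper m => if m < i then 2 * m - 2 else if m ≤ j then m + i - 2 else m - 1 + max i (m - p)
  | lower m => if m < i then 2 * m - 1 else if m = i then i + j - 1 else m - 1 + min q (m + p - 1)

/-- The value `v` if the crossing `y m n` is to the left of `y i j`, and `0` otherwise. -/
def ifPassed (i j m n : ℕ) (v : M) : M := if m < i ∨ m = i ∧ j < n then v else 0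

/-- The counts `V` to the left of the crossing `y i j`, in terms of the values of the crossings
passed so far.  In the end exactly two strips between the upper and the lower strand at the right
cusp `m` have no factor `0` or `a * a`; their values are `a * b` and `b * a`.  The first is
completed by the crossing `y m (m + 1)`, or by `y (q + 1 - p) q` if `m = q`, and the second by
`y m (m + p - 1)`, or by `y (m - 1) m` if `m + p - 1 > q`.  The entries for the upper strand `m` and the lower strand `n`
with `m < n` are never used. -/
structure IsRightMatrix (p q : ℕ) (a b : M) (i j : ℕ) (V : Strand → Strand → M) : Prop where
  upper_upper : ∀ m n, 1 ≤ m → m ≤ q → 1 ≤ n → n ≤ q → V (upper m) (upper n) =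
    if n ≤ p then torusVal p a b (.x m n) else ifPassed i j (n - p) m (torusVal p a b (.y (n - p) m))
  lower_upper : ∀ m n, 1 ≤ m → m ≤ q → 1 ≤ n → n ≤ q →
    V (lower m) (upper n) = if n = m + p then 1 else 0
  lower_lower : ∀ m n, 1 ≤ m → m ≤ q → 1 ≤ n → n ≤ q → V (lower m) (lower n) =
    if m + p ≤ q then ifPassed i j n (m + p) (torusVal p a b (.y n (m + p)))
    else torusVal p a b (.x (m - (q - p)) (n - (q - p)))
  upper_lower_of_lt : ∀ m n, 1 ≤ n → n < m → m ≤ q → V (upper m) (lower n) = 0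
  upper_lower_self : ∀ m, 1 ≤ m → m ≤ q → V (upper m) (lower m) =
    ifPassed i j (if m < q then m else q + 1 - p) (if m < q then m + 1 else q) (a * b) +
    ifPassed i j (if m + p ≤ q + 1 then m else m - 1) (if m + p ≤ q + 1 then m + p - 1 else m)
      (b * a)

/-- The strips completed by a corner of the upper path at `y i j`.  Such a corner takes the upper
path from the lower strand `i` to the upper strand `j`. -/
theorem IsRightMatrix.y_mul_lower_lower {p q : ℕ} (hp : 3 ≤ p) (hpq : p < q) {a b : M}
    (ha : a * a = 0) {i j n : ℕ} {V : Strand → Strand → M} (hV : IsRightMatrix p q a b i j V)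
    (hi : 1 ≤ i) (hij : i < j) (hj : j ≤ q) (hjp : j < i + p) (hn : 1 ≤ n) (hnj : n ≤ j) :
    torusVal p a b (.y i j) * V (lower i) (lower n) =
      (if n = q ∧ j = q ∧ i = q + 1 - p then a * b else 0) +
      (if n = j ∧ q + 1 < j + p ∧ i + 1 = j then b * a else 0) := by
  rw [hV.lower_lower i n hi (by omega) hn (by omega)]
  by_cases h : i + p ≤ q
  · -- The strips on these two strands have a corner at `y n (i + p)`, which has not been passed
    -- if `i < n`, and is not a crossing of the front if `n ≤ i`.
    have : ifPassed i j n (i + p) (torusVal p a b (.y n (i + p))) = 0 := by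
      simp only [ifPassed, torusVal]
      split_ifs <;> first | rfl | (exfalso; omega)
    rw [if_pos h, this, mul_zero, if_neg (by omega), if_neg (by omega), add_zero]
  · rw [if_neg h]
    simp only [torusVal]
    split_ifs <;> first | (exfalso; omega) | simp [ha]

/-- The strips completed by a corner of the lower path at `y i j`.  Such a corner takes the lower
path from the upper strand `j` to the lower strand `i`. -/
theorem IsRightMatrix.upper_upper_mul_y {p q : ℕ} (hp : 3 ≤ p) {a b : M}
    (ha : a * a = 0) {i j m : ℕ} {V : Strand → Strand → M} (hV : IsRightMatrix p q a b i j V)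
    (hi : 1 ≤ i) (hij : i < j) (hj : j ≤ q) (hjp : j < i + p) (hm : i ≤ m) (hmq : m ≤ q) :
    V (upper m) (upper j) * torusVal p a b (.y i j) =
      (if m = i ∧ j = i + 1 then a * b else 0) + (if m = i ∧ j + 1 = i + p then b * a else 0) := by
  rw [hV.upper_upper m j (by omega) hmq (by omega) hj]
  by_cases h : j ≤ p
  · rw [if_pos h]
    simp only [torusVal]
    split_ifs <;> first | (exfalso; omega) | simp [ha]
  · rw [if_neg h, ifPassed, if_pos (by omega)]
    simp only [torusVal]
    split_ifs <;> first | (exfalso; omega) | simp [ha]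

theorem ifPassed_pred {i j m n : ℕ} (hj : 1 ≤ j) (v : M) :
    ifPassed i (j - 1) m n v = ifPassed i j m n v + if m = i ∧ n = j then v else 0 := by
  simp only [ifPassed]
  split_ifs <;> first | (exfalso; omega) | simp

/-- Passing `y i j` multiplies the matrix on both sides by an elementary matrix.  The only
products of two nonzero values which occur in the entries for the upper strand `m` and the lower
strand `n` with `n ≤ m` are `a * a = 0` and, if `n = m`, `a * b` and `b * a`. -/
theorem IsRightMatrix.crossing {p q : ℕ} (hp : 3 ≤ p) (hpq : p < q) {a b : M} (ha : a * a = 0)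
    {i j : ℕ} {V : Strand → Strand → M} (hV : IsRightMatrix p q a b i j V)
    (hi : 1 ≤ i) (hij : i < j) (hj : j ≤ q) (hjp : j < i + p) :
    IsRightMatrix p q a b i (j - 1) fun x y => V x y +
      (if x = upper j then torusVal p a b (.y i j) * V (lower i) y else 0) +
      (if y = lower i then V x (upper j) * torusVal p a b (.y i j) else 0) where
  upper_upper m n hm hmq hn hnq := by
    simp only [upper.injEq, reduceCtorEq, if_false, add_zero]
    rw [hV.upper_upper m n hm hmq hn hnq, hV.lower_upper i n hi (by omega) hn hnq,
      ifPassed_pred (by omega)]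
    by_cases h : m = j ∧ n = i + p
    · obtain ⟨rfl, rfl⟩ := h
      have h1 : ¬ i + p ≤ p := by omega
      simp [h1]
    · split_ifs <;> first | (exfalso; omega) | simp
  lower_upper m n hm hmq hn hnq := by
    simp only [reduceCtorEq, if_false, add_zero]
    exact hV.lower_upper m n hm hmq hn hnq
  lower_lower m n hm hmq hn hnq := by
    simp only [lower.injEq, reduceCtorEq, if_false, add_zero]
    rw [hV.lower_lower m n hm hmq hn hnq, hV.lower_upper m j hm hmq (by omega) hj,
      ifPassed_pred (by omega)]
    by_cases h : n = i ∧ j = m + p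
    · obtain ⟨rfl, rfl⟩ := h
      simp [hj]
    · split_ifs <;> first | (exfalso; omega) | simp
  upper_lower_of_lt m n hn hnm hmq := by
    simp only [upper.injEq, lower.injEq]
    rw [hV.upper_lower_of_lt m n hn hnm hmq]
    have h1 : (if m = j then torusVal p a b (.y i j) * V (lower i) (lower n) else 0) = 0 := by
      split_ifs with h
      · rw [hV.y_mul_lower_lower hp hpq ha hi hij hj hjp hn (by omega), if_neg (by omega),
          if_neg (by omega), add_zero]
      · rfl
    have h2 : (if n = i then V (upper m) (upper j) * torusVal p a b (.y i j) else 0) = 0 := by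
      split_ifs with h
      · rw [hV.upper_upper_mul_y hp ha hi hij hj hjp (by omega) hmq, if_neg (by omega),
          if_neg (by omega), add_zero]
      · rfl
    rw [h1, h2, add_zero, add_zero]
  upper_lower_self m hm hmq := by
    simp only [upper.injEq, lower.injEq]
    rw [hV.upper_lower_self m hm hmq, ifPassed_pred (by omega), ifPassed_pred (by omega)]
    have key : ((if m = j then torusVal p a b (.y i j) * V (lower i) (lower m) else 0) +
          if m = i then V (upper m) (upper j) * torusVal p a b (.y i j) else 0) =
        (if (if m < q then m else q + 1 - p) = i ∧ (if m < q then m + 1 else q) = j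
          then a * b else 0) +
        (if (if m + p ≤ q + 1 then m else m - 1) = i ∧
          (if m + p ≤ q + 1 then m + p - 1 else m) = j then b * a else 0) := by
      by_cases hmj : m = j
      · rw [if_pos hmj, if_neg (by omega), add_zero,
          hV.y_mul_lower_lower hp hpq ha hi hij hj hjp hm (by omega)]
        congr 1 <;> split_ifs <;> first | rfl | (exfalso; omega)
      · by_cases hmi : m = i
        · rw [if_neg hmj, if_pos hmi, zero_add,
            hV.upper_upper_mul_y hp ha hi hij hj hjp (by omega) hmq]
          congr 1 <;> split_ifs <;> first | rfl | (exfalso; omega)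
        · rw [if_neg hmj, if_neg hmi]
          congr 1 <;> split_ifs <;> first | rfl | (exfalso; omega)
    rw [add_assoc, key]
    abel

/-- The counts to the left of the crossing `y i j` are described by a matrix as above. -/
def RightInvariant (p q : ℕ) (a b : M) (i j : ℕ) (W : ℕ → ℕ → M) : Prop :=
  ∃ V, IsRightMatrix p q a b i j V ∧ Describes (Within q) (rightPos p q i j) V W

theorem sweeps_y {p q : ℕ} (hp : 3 ≤ p) (hpq : p < q) {a : M} (b : M) (ha : a * a = 0)
    {i j : ℕ} (hi : 1 ≤ i) (hij : i < j) (hj : j ≤ q) (hjp : j < i + p) :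
    Sweeps (torusVal p a b) (RightInvariant p q a b i j) [.crossing (i + j - 2) (.y i j)]
      (RightInvariant p q a b i (j - 1)) := by
  refine Sweeps.crossing fun W ⟨V, hV, hW⟩ => ⟨?_, _, hV.crossing hp hpq ha hi hij hj hjp,
    hW.crossing (torusVal p a b) ⟨by simp only [idx]; omega, hj⟩ ⟨hi, by simp only [idx]; omega⟩
      ?_ ?_ ?_ ?_ ?_⟩
  · have h := hW (upper j) (lower i) ⟨by simp only [idx]; omega, hj⟩
      ⟨hi, by simp only [idx]; omega⟩ (by simp only [rightPos]; split_ifs <;> omega)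
    rw [hV.upper_lower_of_lt j i hi hij hj] at h
    convert h using 1
    congr 1 <;> simp only [rightPos] <;> split_ifs <;> omega
  · simp only [rightPos]; split_ifs <;> omega
  · simp only [rightPos]; split_ifs <;> omega
  · rintro (m | m) (n | n) ⟨h1, h2⟩ ⟨h3, h4⟩ h5 <;>
      simp only [rightPos, idx, upper.injEq, lower.injEq, reduceCtorEq] at * <;>
      split_ifs at h5 <;> omega
  · rintro (m | m) ⟨h1, h2⟩ <;> rw [eq_follow_crossing_iff] <;>
      simp only [idx, rightPos] at * <;> split_ifs <;> omega
  · rw [hV.lower_upper i j hi (by omega) (by omega) hj, if_neg (by omega)]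

/-- The strands after the inner left cusps, labelled by the right cusps at which they end. -/
def innerLabel (p q : ℕ) : Strand → Strand ⊕ Strand
  | upper m => if m ≤ p then .inl (upper m) else .inr (lower (m - p))
  | lower m => if m + p ≤ q then .inr (upper m) else .inl (lower (m - (q - p)))

/-- Before the first crossing of the right half no strip joins the upper strand `m` to the lower
strand `m`: the lower strand paired with an outer upper strand `m` is the lower strand `m + q - p`. -/
theorem rightInvariant_of_inner {p q : ℕ} (hp : 3 ≤ p) (hpq : p < q) {a b : M} {W : ℕ → ℕ → M}
    (hW : Describes (innerWithin p (q - p)) (innerPos p (q - p)) (innerMatrix p a b) W) :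
    RightInvariant p q a b 1 p W := by
  refine ⟨fun s t => innerMatrix p a b (innerLabel p q s) (innerLabel p q t), ?_,
    hW.relabel (innerLabel p q) ?_ ?_ fun _ _ _ _ => rfl⟩
  · constructor
    · intro m n hm hmq hn hnq
      simp only [innerLabel, ifPassed, torusVal]
      split_ifs <;> simp only [innerMatrix, leftMatrix, cuspMatrix, torusVal] <;>
        (try split_ifs) <;> first | rfl | (exfalso; omega)
    · intro m n hm hmq hn hnq
      simp only [innerLabel]
      split_ifs <;> simp only [innerMatrix, leftMatrix, cuspMatrix] <;>
        (try split_ifs) <;> first | rfl | (exfalso; omega)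
    · intro m n hm hmq hn hnq
      simp only [innerLabel, ifPassed, torusVal]
      split_ifs <;> simp only [innerMatrix, leftMatrix, cuspMatrix, torusVal] <;>
        (try split_ifs) <;> first | rfl | (exfalso; omega)
    · intro m n hn hnm hmq
      simp only [innerLabel]
      split_ifs <;> simp only [innerMatrix, leftMatrix, cuspMatrix]
      all_goals rw [if_neg (by omega)]
    · intro m hm hmq
      have h1 : innerMatrix p a b (innerLabel p q (upper m)) (innerLabel p q (lower m)) = 0 := by
        simp only [innerLabel]
        split_ifs <;> simp only [innerMatrix, leftMatrix, cuspMatrix]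
        all_goals rw [if_neg (by omega)]
      rw [h1, ifPassed, ifPassed, if_neg (by split_ifs <;> omega), if_neg (by split_ifs <;> omega),
        add_zero]
  · rintro (m | m) ⟨h1, h2⟩ <;> simp only [idx, innerLabel] at * <;> split_ifs <;>
      constructor <;> simp only [idx] <;> omega
  · rintro (m | m) ⟨h1, h2⟩ <;> simp only [idx, innerLabel, rightPos] at * <;> split_ifs <;>
      simp only [innerPos] <;> omega

theorem sweeps_torusRight {p q : ℕ} (hp : 3 ≤ p) (hpq : p < q) {a : M} (b : M) (ha : a * a = 0) :
    Sweeps (torusVal p a b) (RightInvariant p q a b 1 p) (torusRight p q)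
      (RightInvariant p q a b (q + 1) q) := by
  refine (Sweeps.flatMap_range' (K := fun i => RightInvariant p q a b (i + 1) (min q (i + p)))
    q fun k hk => ?_).imp (fun W hW => ?_) fun W hW => ?_
  · have h := Sweeps.map_reverse_range' (val := torusVal p a b)
      (K := fun j => RightInvariant p q a b (k + 1) j)
      (e := fun j => .crossing (k + 1 + j - 2) (.y (k + 1) j)) (k + 1)
      (min q (k + 1 + p - 1) - (k + 1))
      fun m hm hm' => sweeps_y hp hpq b ha (i := k + 1) (j := m + 1) (by omega) (by omega)
        (by omega) (by omega)
    rw [show k + 1 + (min q (k + 1 + p - 1) - (k + 1)) = min q (k + p) by omega] at h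
    refine h.imp (fun _ h => h) ?_
    rintro W ⟨V, hV, hW⟩
    refine ⟨V, ?_, hW.congr ?_ fun _ _ _ _ => rfl⟩
    · have hy : ∀ m n, n ≤ q →
          ifPassed (k + 1 + 1) (min q (k + 1 + p)) m n (torusVal p a b (.y m n)) =
            ifPassed (k + 1) (k + 1) m n (torusVal p a b (.y m n)) := by
        intro m n hn
        -- The two conditions differ only on pairs with `n ≤ m` or `n > m + p - 1`, with value `0`.
        simp only [ifPassed, torusVal]
        split_ifs <;> first | rfl | (exfalso; omega)
      constructor
      · intro m n hm hmq hn hnq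
        rw [hy _ _ hmq, hV.upper_upper m n hm hmq hn hnq]
      · exact hV.lower_upper
      · intro m n hm hmq hn hnq
        rw [hV.lower_lower m n hm hmq hn hnq]
        split_ifs with h
        · rw [hy _ _ h]
        · rfl
      · exact hV.upper_lower_of_lt
      · intro m hm hmq
        rw [hV.upper_lower_self m hm hmq]
        simp only [ifPassed]
        congr 1 <;> split_ifs <;> first | rfl | (exfalso; omega)
    · rintro (m | m) ⟨h1, h2⟩ <;> simp only [idx, rightPos] at * <;> split_ifs <;> omega
  · rwa [zero_add, zero_add, min_eq_right hpq.le]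
  · rwa [min_eq_left (by omega)] at hW

theorem sweeps_torusEvents {p q : ℕ} (hp : 3 ≤ p) (hpq : p < q) {a : M} (b : M)
    (ha : a * a = 0) :
    Sweeps (torusVal p a b) (fun W => W = 0) (torusEvents p q)
      (RightInvariant p q a b (q + 1) q) :=
  ((((sweeps_torusOuterCusps _ p).append (sweeps_torusLeft hp b ha)).append
    (sweeps_torusInnerCusps _ p q a b)).imp (fun _ h => h)
      fun _ h => rightInvariant_of_inner hp hpq h).append (sweeps_torusRight hp hpq b ha)

theorem RightInvariant.apply_cusp {p q : ℕ} (hp : 3 ≤ p) (hpq : p < q) {a b : M}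
    {W : ℕ → ℕ → M} (hW : RightInvariant p q a b (q + 1) q W) {i : ℕ} (hi : i < q) :
    W (2 * i) (2 * i + 1) = a * b + b * a := by
  obtain ⟨V, hV, hW⟩ := hW
  have h := hW (upper (i + 1)) (lower (i + 1)) ⟨by simp only [idx]; omega, hi⟩
    ⟨by simp only [idx]; omega, hi⟩ (by simp only [rightPos]; split_ifs <;> omega)
  rw [hV.upper_lower_self (i + 1) (by omega) hi] at h
  convert h using 1
  · congr 1 <;> simp only [rightPos] <;> split_ifs <;> omega
  · simp only [ifPassed]
    congr 1 <;> split_ifs <;> first | rfl | (exfalso; omega)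

end Torus

theorem mainTheorem6 (p q : ℕ) (hp : 3 ≤ p) (hpq : p < q) (hcop : Nat.Coprime p q)
    (a b : Matrix (Fin 2) (Fin 2) (ZMod 2))
    (ha : a ^ 2 = 0) (hb : b ^ 2 = 0) (hab : a * b + b * a = 1) :
    (∀ v : (torusFront p q).Ch, torusRep p q a b ((torusFront p q).d v) = 0) ∧
      ∃! φ : (torusFront p q).CharAlg →ₐ[ZMod 2] Matrix (Fin 2) (Fin 2) (ZMod 2),
        ∀ v : (torusFront p q).Ch, φ ((torusFront p q).toCharAlg v) = torusRep p q a b v := by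
  have ha' : a * a = 0 := by rw [← sq, ha]
  obtain ⟨hbal, hend⟩ := sweeps_torusEvents hp hpq b ha' 0 rfl
  have hd := SimpleFront.map_d_eq_zero (torusRep p q a b) <|
    SimpleFront.map_dGen_eq_zero (torusVal p a b) (torusRep p q a b)
      (fun c => by
        rw [torusRep, FreeAlgebra.lift_ι_apply]
        rfl)
      hbal fun i hi => by
        rw [← hab]
        exact hend.apply_cusp hp hpq (hi.trans_eq (cusps_torusEvents hpq.le))
  exact ⟨hd, SimpleFront.existsUnique_charAlg_hom _ hd⟩
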